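/- Let $d,m\ge 1$ be integers and let $h(d,m)$ be the Danzer–Grünbaum Helly number for $m$-piercing axis-parallel boxes in $\mathbb{R}^d$, i.e. $h(d,1)=2$; $h(1,m)=m+1$; $h(d,2)=3d$ if $d$ is odd and $h(d,2)=3d-1$ if $d$ is even; $h(2,3)=16$; and $h(d,m)=\infty$ in all remaining cases. Assume that $h=h(d,m)$ is finite. Let $P=\{\sum_{i=1}^d t_i v_i : t_i\in[0,1]\}$ be the parallelotope ("parallelogram") spanned by linearly independent vectors $v_1,\dots,v_d\in\mathbb{R}^d$ (for instance an axis-parallel box), and let $S\subset\mathbb{R}^d$ be a finite set of at least $h$ points. If every subset of $S$ of exactly $h$ points is contained in the union of $m$ translated copies of $P$, then $S$ is contained in the union of $m$ translated copies of $P$. -/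

import Mathlib

/-- The Helly numbers `h(d, m)` of Danzer and Grünbaum: `h(d, m)` is the least `h` such that a
family of axis-parallel boxes in `ℝ^d` can be pierced by `m` points as soon as each of its
`h`-membered subfamilies can; here `d, m ≥ 1`. Their values are
`h(d, 1) = 2`; `h(1, m) = m + 1`; `h(d, 2) = 3 d` for odd `d` and `3 d - 1` for even `d`;
`h(2, 3) = 16`; and `h(d, m) = ∞` in all other cases. -/
def danzerGrunbaumNumber (d m : ℕ) : ℕ∞ :=
  if m = 1 then 2
  else if d = 1 then ((m + 1 : ℕ) : ℕ∞)
  else if m = 2 then (if Odd d then ((3 * d : ℕ) : ℕ∞) else ((3 * d - 1 : ℕ) : ℕ∞))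
  else if d = 2 ∧ m = 3 then 16
  else ⊤

/-- The points of `T` are contained in (the union of) `m` translated copies of `P`. -/
def ContainedInTranslates {d : ℕ} (m : ℕ) (P T : Set (EuclideanSpace ℝ (Fin d))) : Prop :=
  ∃ c : Fin m → EuclideanSpace ℝ (Fin d),
    T ⊆ ⋃ i : Fin m, (fun x => c i + x) '' P

/-! In coordinates with respect to `v`, translates of `P` are unit cubes, so covering by `m` of them
means colouring the points so that no two of one colour differ by more than 1 in a coordinate. It
suffices to find, in an uncolourable set, an uncolourable subset of at most `h` points.

For `m = 1` a far pair works; for `d = 1` the greedy algorithm gives `m + 1` separated points. For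
`m = 2` the obstruction is a shortest odd closed walk in `farGraph`: it has no chords, which allows
at most three edges per coordinate direction (`length_le_of_minimal_odd_farGraph`).

For `d = 2`, `m = 3`, four extreme points of the bounding box receive three colours, so some square
sits in a corner of the box. Six points exclude two opposite corners (`IsBounding.exists_diagonal`),
hence `6 + 6 + 4 = 16`. -/

/-! ### Translates of a parallelotope as colour classes -/

/-- `T` can be coloured with `m` colours so that the coordinates of points of the same colour
differ by at most one. -/
def UnitColorable {E ι : Type*} (x : E → ι → ℝ) (m : ℕ) (T : Finset E) : Prop :=
  ∃ f : E → ℕ, (∀ s ∈ T, f s < m) ∧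
    ∀ s ∈ T, ∀ t ∈ T, f s = f t → ∀ i, x s i - x t i ≤ 1

theorem containedInTranslates_iff_unitColorable {d m : ℕ} (hm : 0 < m)
    (b : Module.Basis (Fin d) ℝ (EuclideanSpace ℝ (Fin d)))
    (T : Finset (EuclideanSpace ℝ (Fin d))) :
    ContainedInTranslates m (parallelepiped b) (T : Set (EuclideanSpace ℝ (Fin d))) ↔
      UnitColorable (fun s i => b.repr s i) m T := by
  have key : ∀ c s : EuclideanSpace ℝ (Fin d), s ∈ (fun x => c + x) '' parallelepiped b ↔
      ∀ i, b.repr c i ≤ b.repr s i ∧ b.repr s i ≤ b.repr c i + 1 := by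
    intro c s
    have h1 : s ∈ (fun x => c + x) '' parallelepiped b ↔ s - c ∈ parallelepiped b := by
      constructor
      · rintro ⟨y, hy, rfl⟩
        simpa using hy
      · intro h
        exact ⟨s - c, h, by simp⟩
    rw [h1, parallelepiped_basis_eq]
    simp only [Set.mem_ofPred_eq, Set.mem_Icc, map_sub, Finsupp.sub_apply]
    refine forall_congr' fun i => ?_
    constructor <;> rintro ⟨h, h'⟩ <;> constructor <;> linarith
  constructor
  · rintro ⟨c, hc⟩
    have hc' : ∀ s, ∃ k : Fin m, s ∈ T → s ∈ (fun x => c k + x) '' parallelepiped b := by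
      intro s
      by_cases hs : s ∈ T
      · obtain ⟨k, hk⟩ := Set.mem_iUnion.1 (hc hs)
        exact ⟨k, fun _ => hk⟩
      · exact ⟨⟨0, hm⟩, fun h => absurd h hs⟩
    choose f hf using hc'
    refine ⟨fun s => f s, fun s _ => (f s).2, fun s hs t ht hst i => ?_⟩
    have h1 := (key _ _).1 (hf s hs) i
    have h2 := (key _ _).1 (hf t ht) i
    rw [Fin.ext hst] at h1
    simp only
    linarith [h1.2, h2.1]
  · rintro ⟨f, hf, hT⟩
    -- Each cube is placed at the coordinatewise infimum of its colour class; empty classes do not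
    -- matter.
    refine ⟨fun k => b.equivFun.symm fun i => sInf ((fun s => b.repr s i) '' {s | s ∈ T ∧ f s = k}),
      fun s hs => Set.mem_iUnion.2 ⟨⟨f s, hf s hs⟩, (key _ _).2 fun i => ?_⟩⟩
    have hr : ∀ g : Fin d → ℝ, b.repr (b.equivFun.symm g) i = g i := by
      intro g
      rw [← Module.Basis.equivFun_apply, LinearEquiv.apply_symm_apply]
    rw [hr]
    have hfin : ((fun s => b.repr s i) '' {t | t ∈ T ∧ f t = f s}).Finite :=
      (T.finite_toSet.subset fun t ht => ht.1).image _
    have hmem : b.repr s i ∈ ((fun s => b.repr s i) '' {t | t ∈ T ∧ f t = f s}) :=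
      ⟨s, ⟨hs, rfl⟩, rfl⟩
    constructor
    · exact csInf_le hfin.bddBelow hmem
    · have : b.repr s i - 1 ≤ sInf ((fun s => b.repr s i) '' {t | t ∈ T ∧ f t = f s}) := by
        refine le_csInf ⟨_, hmem⟩ ?_
        rintro _ ⟨t, ⟨ht, hft⟩, rfl⟩
        have := hT s hs t ht hft.symm i
        simp only at this ⊢
        linarith
      linarith

/-! ### One cube, or dimension one -/

/-- Greedy covering of finitely many reals by unit intervals. -/
theorem exists_separated_or_coloring {E : Type*} (x : E → ℝ) (m : ℕ) (S : Finset E) :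
    (∃ T ⊆ S, T.card = m + 1 ∧ ∀ s ∈ T, ∀ t ∈ T, s ≠ t → 1 < |x s - x t|) ∨
      ∃ f : E → ℕ, (∀ s ∈ S, f s < m) ∧ ∀ s ∈ S, ∀ t ∈ S, f s = f t → x s - x t ≤ 1 := by
  classical
  induction m generalizing S with
  | zero =>
    rcases S.eq_empty_or_nonempty with rfl | ⟨a, ha⟩
    · right
      exact ⟨fun _ => 0, by simp, by simp⟩
    · left
      refine ⟨{a}, by simpa using ha, by simp, ?_⟩
      simp only [Finset.mem_singleton]
      rintro s rfl t rfl h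
      exact absurd rfl h
  | succ m ih =>
    rcases S.eq_empty_or_nonempty with rfl | hS
    · right
      exact ⟨fun _ => 0, by simp, by simp⟩
    obtain ⟨a, ha, hmin⟩ := S.exists_min_image x hS
    -- The interval starting at the minimum `a` takes colour `m`; every point beyond it is separated
    -- from `a`.
    rcases ih (S.filter fun s => x a + 1 < x s) with ⟨T, hT, hc, hsep⟩ | ⟨f, hf, hfT⟩
    · left
      have hlt : ∀ s ∈ T, x a + 1 < x s := fun s hs => (Finset.mem_filter.1 (hT hs)).2
      have haT : a ∉ T := fun h => by linarith [hlt a h]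
      refine ⟨insert a T, ?_, by rw [Finset.card_insert_of_notMem haT, hc], ?_⟩
      · intro s hs
        rcases Finset.mem_insert.1 hs with rfl | hs
        · exact ha
        · exact (Finset.mem_filter.1 (hT hs)).1
      · intro s hs t ht hst
        rcases Finset.mem_insert.1 hs with hs' | hs' <;>
          rcases Finset.mem_insert.1 ht with ht' | ht'
        · exact absurd (hs'.trans ht'.symm) hst
        · rw [lt_abs, hs']; right; linarith [hlt t ht']
        · rw [lt_abs, ht']; left; linarith [hlt s hs']
        · exact hsep s hs' t ht' hst
    · right
      refine ⟨fun s => if x a + 1 < x s then f s else m, fun s hs => ?_, fun s hs t ht hst => ?_⟩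
      · dsimp only
        split_ifs with h
        · exact (hf s (by simp [hs, h])).trans (Nat.lt_succ_self m)
        · exact Nat.lt_succ_self m
      · dsimp only at hst
        split_ifs at hst with h h' h'
        · exact hfT s (by simp [hs, h]) t (by simp [ht, h']) hst
        · have := hf s (by simp [hs, h]); omega
        · have := hf t (by simp [ht, h']); omega
        · linarith [hmin t ht]

theorem not_coloring_of_separated {E : Type*} {x : E → ℝ} {m : ℕ} {T : Finset E}
    (hc : T.card = m + 1) (hsep : ∀ s ∈ T, ∀ t ∈ T, s ≠ t → 1 < |x s - x t|) (f : E → ℕ)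
    (hf : ∀ s ∈ T, f s < m) (hT : ∀ s ∈ T, ∀ t ∈ T, f s = f t → x s - x t ≤ 1) : False := by
  obtain ⟨s, hs, t, ht, hne, hst⟩ := Finset.exists_ne_map_eq_of_card_lt_of_maps_to
    (s := T) (t := Finset.range m) (f := f) (by simp [hc]) (fun s hs => by simpa using hf s hs)
  have h := hsep s hs t ht hne
  rw [lt_abs] at h
  have h1 := hT s hs t ht hst
  have h2 := hT t ht s hs hst.symm
  rcases h with h | h <;> linarith

theorem exists_card_le_not_unitColorable_one {E ι : Type*} (x : E → ι → ℝ) (S : Finset E)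
    (hS : ¬ UnitColorable x 1 S) : ∃ T ⊆ S, T.card ≤ 2 ∧ ¬ UnitColorable x 1 T := by
  classical
  by_contra! hcon
  refine hS ⟨fun _ => 0, by simp, fun s hs t ht _ => ?_⟩
  obtain ⟨f, hf, hT⟩ := hcon {s, t} (by simp [Finset.insert_subset_iff, hs, ht]) Finset.card_le_two
  have h1 := hf s (by simp)
  have h2 := hf t (by simp)
  exact hT s (by simp) t (by simp) (by omega)

theorem exists_card_le_not_unitColorable_unique {E ι : Type*} [Unique ι] (x : E → ι → ℝ) (m : ℕ)
    (S : Finset E) (hS : ¬ UnitColorable x m S) :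
    ∃ T ⊆ S, T.card ≤ m + 1 ∧ ¬ UnitColorable x m T := by
  rcases exists_separated_or_coloring (fun s => x s default) m S with ⟨T, hT, hc, hsep⟩ | ⟨f, hf, h⟩
  · exact ⟨T, hT, hc.le, fun ⟨f, hf, h⟩ =>
      not_coloring_of_separated hc hsep f hf fun s hs t ht hst => h s hs t ht hst default⟩
  · refine absurd ⟨f, hf, fun s hs t ht hst i => ?_⟩ hS
    rw [Unique.eq_default i]
    exact h s hs t ht hst

/-! ### Two cubes: shortest odd closed walks -/

/-- An odd closed walk of minimal length has no chords. -/
theorem SimpleGraph.Walk.eq_of_adj_getVert_of_minimal_odd {V : Type*} {G : SimpleGraph V} {v : V}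
    (c : G.Walk v v) (ho : Odd c.length)
    (hmin : ∀ (u : V) (c' : G.Walk u u), Odd c'.length → c.length ≤ c'.length) {k l : ℕ}
    (hkl : k ≤ l) (hl : l ≤ c.length) (h : G.Adj (c.getVert k) (c.getVert l)) :
    l = k + 1 ∨ l + 1 = k + c.length := by
  -- The chord splits `c` into two closed walks of total length `c.length + 2`, so one is odd, and
  -- minimality applies to it.
  let c₁ := SimpleGraph.Walk.cons h.symm (((c.take l).drop k).copy
    (by rw [SimpleGraph.Walk.take_getVert, min_eq_right hkl]) rfl)
  let c₂ := (c.take k).append (SimpleGraph.Walk.cons h (c.drop l))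
  have h₁ : c₁.length = l - k + 1 := by simp [c₁, hl]
  have h₂ : c₂.length = k + (c.length - l + 1) := by simp [c₂, hkl.trans hl]
  have m₁ := hmin _ c₁
  have m₂ := hmin _ c₂
  rw [h₁] at m₁
  rw [h₂] at m₂
  have hne : k ≠ l := by
    rintro rfl
    exact h.ne rfl
  rw [Nat.odd_iff] at *
  by_cases hpar : (l - k + 1) % 2 = 1
  · have := m₁ hpar
    omega
  · have := m₂ (by omega)
    omega

/-- The graph joining two points of `S` if they do not fit into a common unit cube. -/
def farGraph {E ι : Type*} (x : E → ι → ℝ) (S : Finset E) : SimpleGraph E where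
  Adj s t := s ∈ S ∧ t ∈ S ∧ ∃ i, 1 < |x s i - x t i|
  symm := ⟨fun s t ⟨hs, ht, i, hi⟩ => ⟨ht, hs, i, by rwa [abs_sub_comm]⟩⟩
  loopless := ⟨fun s ⟨_, _, i, hi⟩ => by simp at hi; linarith⟩

theorem unitColorable_iff_farGraph_colorable {E ι : Type*} (x : E → ι → ℝ) {m : ℕ} (hm : 0 < m)
    (S : Finset E) : UnitColorable x m S ↔ (farGraph x S).Colorable m := by
  classical
  constructor
  · rintro ⟨f, hf, h⟩
    refine ⟨SimpleGraph.Coloring.mk (fun s => if hs : s ∈ S then ⟨f s, hf s hs⟩ else ⟨0, hm⟩) ?_⟩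
    rintro s t ⟨hs, ht, i, hi⟩ heq
    simp only [hs, ht, dif_pos, Fin.mk.injEq] at heq
    have h1 := h s hs t ht heq i
    have h2 := h t ht s hs heq.symm i
    rw [lt_abs] at hi
    rcases hi with hi | hi <;> linarith
  · rintro ⟨C⟩
    refine ⟨fun s => C s, fun s _ => (C s).2, fun s hs t ht hst i => ?_⟩
    by_contra! hi
    exact C.valid (show (farGraph x S).Adj s t from ⟨hs, ht, i, lt_abs.2 (Or.inl hi)⟩)
      (Fin.ext hst)

/-- Among two edges of an indifference complement graph on the line, some end of one is joined to
some end of the other. -/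
theorem one_lt_abs_sub_of_one_lt_abs_sub {a b c d : ℝ} (h : 1 < |a - b|) (h' : 1 < |c - d|) :
    1 < |a - c| ∨ 1 < |a - d| ∨ 1 < |b - c| ∨ 1 < |b - d| := by
  simp only [lt_abs] at *
  by_contra! hcon
  rcases h with h | h <;> rcases h' with h' | h' <;> linarith

/-- A set of at least four indices has two that are not at cyclic distance at most two. -/
theorem card_le_three_of_cyclic_close {n : ℕ} (hn : 7 ≤ n) (K : Finset ℕ)
    (hK : ∀ k ∈ K, k < n)
    (hclose : ∀ k ∈ K, ∀ l ∈ K, k < l → l ≤ k + 2 ∨ k + n ≤ l + 2) : K.card ≤ 3 := by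
  by_contra! hc
  obtain ⟨L, hL, hLc⟩ := Finset.exists_subset_card_eq (show 4 ≤ K.card from hc)
  let g := L.orderEmbOfFin hLc
  have hg : ∀ j, g j ∈ K := fun j => hL (L.orderEmbOfFin_mem hLc j)
  have l01 : g 0 < g 1 := g.strictMono (by decide)
  have l12 : g 1 < g 2 := g.strictMono (by decide)
  have l23 : g 2 < g 3 := g.strictMono (by decide)
  have c02 := hclose _ (hg 0) _ (hg 2) (l01.trans l12)
  have c13 := hclose _ (hg 1) _ (hg 3) (l12.trans l23)
  have c03 := hclose _ (hg 0) _ (hg 3) (l01.trans (l12.trans l23))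
  have c12 := hclose _ (hg 1) _ (hg 2) l12
  have c01 := hclose _ (hg 0) _ (hg 1) l01
  have c23 := hclose _ (hg 2) _ (hg 3) l23
  have n3 := hK _ (hg 3)
  omega

/-- A shortest odd closed walk in the graph of far points of `ℝ^d` has length at most `3 d`. -/
theorem length_le_of_minimal_odd_farGraph {E : Type*} {d : ℕ} (hd : 2 ≤ d) (x : E → Fin d → ℝ)
    (S : Finset E) {v : E} (c : (farGraph x S).Walk v v) (ho : Odd c.length)
    (hmin : ∀ (u : E) (c' : (farGraph x S).Walk u u), Odd c'.length → c.length ≤ c'.length) :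
    c.length ≤ 3 * d := by
  classical
  by_contra! hlt
  have hadj : ∀ k : Fin c.length, ∃ i, 1 < |x (c.getVert k) i - x (c.getVert (k + 1)) i| :=
    fun k => (c.adj_getVert_succ k.2).2.2
  choose dir hdir using hadj
  -- More than `3 * d` edges put at least four in one direction `i`.
  obtain ⟨i, -, hi⟩ := Finset.exists_lt_card_fiber_of_mul_lt_card_of_maps_to
    (s := (Finset.univ : Finset (Fin c.length))) (t := (Finset.univ : Finset (Fin d))) (f := dir)
    (n := 3) (fun _ _ => Finset.mem_univ _) (by simp; omega)
  refine absurd hi (not_lt.2 ?_)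
  rw [← Finset.card_map Fin.valEmbedding]
  refine card_le_three_of_cyclic_close (n := c.length) (by omega) _ ?_ ?_
  · simp only [Finset.mem_map]
    rintro _ ⟨k, _, rfl⟩
    exact k.2
  · simp only [Finset.mem_map, Finset.mem_filter, Finset.mem_univ, true_and]
    rintro _ ⟨k, hk, rfl⟩ _ ⟨l, hl, rfl⟩ hkl
    simp only [Fin.valEmbedding_apply] at hkl ⊢
    have hmem : ∀ j, j ≤ c.length → c.getVert j ∈ S := by
      intro j hj
      rcases hj.lt_or_eq with hj | rfl
      · exact (c.adj_getVert_succ hj).1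
      · rw [c.getVert_length, ← c.getVert_zero]
        exact (c.adj_getVert_succ ho.pos).1
    have hk' := k.2
    have hl' := l.2
    have e1 := hdir k
    have e2 := hdir l
    rw [hk] at e1
    rw [hl] at e2
    have chord : ∀ p q : ℕ, p ≤ q → q ≤ c.length →
        1 < |x (c.getVert p) i - x (c.getVert q) i| → q = p + 1 ∨ q + 1 = p + c.length :=
      fun p q hpq hq h => c.eq_of_adj_getVert_of_minimal_odd ho hmin hpq hq
        ⟨hmem p (hpq.trans hq), hmem q hq, i, h⟩
    -- Two edges of direction `i` have adjacent ends; without chords, these ends are neighbours on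
    -- the walk, so the edges are cyclically close.
    rcases one_lt_abs_sub_of_one_lt_abs_sub e1 e2 with h | h | h | h
    · have := chord _ _ (by omega) (by omega) h; omega
    · have := chord _ _ (by omega) (by omega) h; omega
    · have := chord _ _ (by omega) (by omega) h; omega
    · have := chord _ _ (by omega) (by omega) h; omega

/-- Non-bipartiteness is witnessed by the vertices of a shortest odd closed walk. The bound `h` is
abstract because parity improves `3 * d` when `d` is even. -/
theorem exists_card_le_not_unitColorable_two {E : Type*} {d h : ℕ} (hd : 2 ≤ d)
    (hh : ∀ n, Odd n → n ≤ 3 * d → n ≤ h) (x : E → Fin d → ℝ) (S : Finset E)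
    (hS : ¬ UnitColorable x 2 S) : ∃ T ⊆ S, T.card ≤ h ∧ ¬ UnitColorable x 2 T := by
  classical
  simp only [unitColorable_iff_farGraph_colorable x two_pos,
    SimpleGraph.two_colorable_iff_forall_loop_even] at hS ⊢
  push Not at hS
  have hex : ∃ n, Odd n ∧ ∃ (v : E) (c : (farGraph x S).Walk v v), c.length = n := by
    obtain ⟨v, c, hc⟩ := hS
    exact ⟨_, Nat.not_even_iff_odd.1 hc, v, c, rfl⟩
  obtain ⟨ho, v, c, hc⟩ := Nat.find_spec hex
  rw [← hc] at ho
  have hmin : ∀ (u : E) (c' : (farGraph x S).Walk u u), Odd c'.length →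
      c.length ≤ c'.length := fun u c' ho' => by
    rw [hc]
    exact Nat.find_min' hex ⟨ho', u, c', rfl⟩
  have hsupp : ∀ a ∈ c.support, a ∈ (Finset.range c.length).image c.getVert := by
    intro a ha
    obtain ⟨k, rfl, hk⟩ := SimpleGraph.Walk.mem_support_iff_exists_getVert.1 ha
    rw [Finset.mem_image]
    rcases hk.lt_or_eq with hk | rfl
    · exact ⟨k, Finset.mem_range.2 hk, rfl⟩
    · exact ⟨0, Finset.mem_range.2 ho.pos, by simp⟩
  refine ⟨(Finset.range c.length).image c.getVert, ?_, ?_, fun heven => ?_⟩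
  · intro a ha
    obtain ⟨k, hk, rfl⟩ := Finset.mem_image.1 ha
    exact (c.adj_getVert_succ (Finset.mem_range.1 hk)).1
  · exact Finset.card_image_le.trans (by
      rw [Finset.card_range]
      exact hh _ ho (length_le_of_minimal_odd_farGraph hd x S c ho hmin))
  · have htr : ∀ e ∈ c.edges,
        e ∈ (farGraph x ((Finset.range c.length).image c.getVert)).edgeSet := by
      intro e
      induction e with
      | h a b =>
        intro he
        exact ⟨hsupp a (c.fst_mem_support_of_mem_edges he),
          hsupp b (c.snd_mem_support_of_mem_edges he), (c.adj_of_mem_edges he).2.2⟩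
    have := heven _ (c.transfer _ htr)
    rw [SimpleGraph.Walk.length_transfer] at this
    exact Nat.not_even_iff_odd.2 ho this

/-! ### Three squares in the plane -/

/-- `f` restricted to `T` is a colouring of planar points (with coordinates `u` and `w`) whose
classes fit into unit squares. -/
def IsSquareColoring {E : Type*} (u w : E → ℝ) (T : Finset E) (f : E → ℕ) : Prop :=
  (∀ s ∈ T, f s < 3) ∧ ∀ s ∈ T, ∀ t ∈ T, f s = f t → u s - u t ≤ 1 ∧ w s - w t ≤ 1

/-- The points `l`, `r`, `b`, `t` of `S` attain the sides of the bounding box of `S`, and both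
sides of this box are longer than one. -/
structure IsBounding {E : Type*} (u w : E → ℝ) (S : Finset E) (l r b t : E) : Prop where
  left_mem : l ∈ S
  right_mem : r ∈ S
  bot_mem : b ∈ S
  top_mem : t ∈ S
  left_le : ∀ s ∈ S, u l ≤ u s
  le_right : ∀ s ∈ S, u s ≤ u r
  bot_le : ∀ s ∈ S, w b ≤ w s
  le_top : ∀ s ∈ S, w s ≤ w t
  width : 1 < u r - u l
  height : 1 < w t - w b

section

variable {E : Type*} {u w : E → ℝ} {S T : Finset E} {l r b t : E}

/-- The half-turn carries statements about the lower left corner to the upper right one; `reflect`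
exchanges the two diagonals. -/
theorem IsBounding.rotate (h : IsBounding u w S l r b t) : IsBounding (-u) (-w) S r l t b where
  left_mem := h.right_mem
  right_mem := h.left_mem
  bot_mem := h.top_mem
  top_mem := h.bot_mem
  left_le s hs := by simpa using h.le_right s hs
  le_right s hs := by simpa using h.left_le s hs
  bot_le s hs := by simpa using h.le_top s hs
  le_top s hs := by simpa using h.bot_le s hs
  width := by simpa only [Pi.neg_apply, neg_sub_neg] using h.width
  height := by simpa only [Pi.neg_apply, neg_sub_neg] using h.height

theorem IsBounding.reflect (h : IsBounding u w S l r b t) : IsBounding u (-w) S l r t b where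
  left_mem := h.left_mem
  right_mem := h.right_mem
  bot_mem := h.top_mem
  top_mem := h.bot_mem
  left_le := h.left_le
  le_right := h.le_right
  bot_le s hs := by simpa using h.le_top s hs
  le_top s hs := by simpa using h.bot_le s hs
  width := h.width
  height := by simpa only [Pi.neg_apply, neg_sub_neg] using h.height

theorem IsSquareColoring.reflect {f : E → ℕ} (h : IsSquareColoring u w T f) :
    IsSquareColoring u (-w) T f := by
  refine ⟨h.1, fun s hs t ht hst => ⟨(h.2 s hs t ht hst).1, ?_⟩⟩
  simpa only [Pi.neg_apply, neg_sub_neg] using (h.2 t ht s hs hst.symm).2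

theorem IsSquareColoring.rotate {f : E → ℕ} (h : IsSquareColoring u w T f) :
    IsSquareColoring (-u) (-w) T f := by
  refine ⟨h.1, fun s hs t ht hst => ⟨?_, (h.reflect.2 s hs t ht hst).2⟩⟩
  simpa only [Pi.neg_apply, neg_sub_neg] using (h.2 t ht s hs hst.symm).1

/-- The points outside the unit square in the lower left corner of the bounding box. -/
def OffLow (u w : E → ℝ) (l b s : E) : Prop := 1 < u s - u l ∨ 1 < w s - w b

theorem offLow_neg {s : E} : OffLow (-u) (-w) r t s ↔ 1 < u r - u s ∨ 1 < w t - w s := by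
  simp only [OffLow, Pi.neg_apply, neg_sub_neg]

/-- If `S` is not covered by three unit squares, then two points outside the lower left and the
upper right corner squares do not fit into one unit square. -/
theorem IsBounding.exists_far (h : IsBounding u w S l r b t)
    (hS : ∀ f, ¬ IsSquareColoring u w S f) :
    ∃ p ∈ S, ∃ q ∈ S, OffLow u w l b p ∧ OffLow u w l b q ∧ OffLow (-u) (-w) r t p ∧
      OffLow (-u) (-w) r t q ∧ (1 < u q - u p ∨ 1 < w q - w p) := by
  classical
  by_contra! hcon
  simp only [offLow_neg] at hcon
  -- Colours 0 and 1 are the two corner squares; without a far pair, the remaining points fit into a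
  -- third.
  refine hS (fun s => if OffLow u w l b s then
    (if 1 < u r - u s ∨ 1 < w t - w s then 2 else 1) else 0) ⟨fun s _ => ?_, ?_⟩
  · dsimp only
    split_ifs <;> omega
  · intro s hs s' hs' hss
    have h1 := h.left_le s' hs'
    have h2 := h.bot_le s' hs'
    have h3 := h.le_right s hs
    have h4 := h.le_top s hs
    dsimp only at hss
    split_ifs at hss with a1 a2 a3 a4 a3 a4 a3 a4
    any_goals omega
    · exact hcon s' hs' s hs a3 a1 a4 a2
    · simp only [not_or, not_lt] at a2 a4
      constructor <;> linarith
    · simp only [OffLow, not_or, not_lt] at a1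
      constructor <;> linarith

/-- Few points of `S` that, together with two far points outside the lower left and upper right
corner squares, exclude the lower left corner square from all covers by three unit squares. -/
theorem IsBounding.exists_corner (h : IsBounding u w S l r b t)
    (hS : ∀ f, ¬ IsSquareColoring u w S f) :
    ∃ B ⊆ S, B.card ≤ 3 ∧
      (∀ p ∈ S, ∀ q ∈ S, OffLow u w l b p → OffLow u w l b q → OffLow (-u) (-w) r t p →
        OffLow (-u) (-w) r t q → (1 < u q - u p ∨ 1 < w q - w p) →
        ∀ T ⊆ S, B ⊆ T → p ∈ T → q ∈ T → l ∈ T → r ∈ T → b ∈ T → t ∈ T →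
        ∀ f, IsSquareColoring u w T f → f l ≠ f b) ∧
      (B.card ≤ 2 ∨ ∃ l' ∈ B, ∃ b' ∈ B, OffLow u w l b l' ∧ OffLow u w l b b' ∧
        OffLow (-u) (-w) r t l' ∧ OffLow (-u) (-w) r t b' ∧
        ∀ s ∈ S, OffLow u w l b s → u l' ≤ u s ∧ w b' ≤ w s) := by
  classical
  have hw := h.width
  have hh := h.height
  have hr : OffLow u w l b r := Or.inl hw
  have ht : OffLow u w l b t := Or.inr hh
  obtain ⟨l', hl', hlmin⟩ := (S.filter (OffLow u w l b)).exists_min_image u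
    ⟨r, Finset.mem_filter.2 ⟨h.right_mem, hr⟩⟩
  obtain ⟨b', hb', hbmin⟩ := (S.filter (OffLow u w l b)).exists_min_image w
    ⟨r, Finset.mem_filter.2 ⟨h.right_mem, hr⟩⟩
  simp only [Finset.mem_filter, and_imp] at hl' hb' hlmin hbmin
  -- Outside the lower left square, the upper left and lower right squares of the remaining bounding
  -- box cannot cover everything; `e` is a missed point.
  obtain ⟨e, heS, he, he1, he2⟩ : ∃ e ∈ S, OffLow u w l b e ∧
      (1 < u e - u l' ∨ 1 < w t - w e) ∧ (1 < u r - u e ∨ 1 < w e - w b') := by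
    by_contra! hcon
    refine hS (fun s => if OffLow u w l b s then
      (if 1 < u s - u l' ∨ 1 < w t - w s then 2 else 1) else 0) ⟨fun s _ => ?_, ?_⟩
    · dsimp only
      split_ifs <;> omega
    · intro s hs s' hs' hss
      have h1 := h.left_le s' hs'
      have h2 := h.bot_le s' hs'
      have h3 := h.le_right s hs
      have h4 := h.le_top s hs
      dsimp only at hss
      split_ifs at hss with a1 a2 a3 a4 a3 a4 a3 a4
      any_goals omega
      · have h5 := hbmin s' hs' a3
        have h6 := hcon s hs a1 a2
        have h7 := hcon s' hs' a3 a4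
        constructor <;> linarith
      · have h5 := hlmin s' hs' a3
        simp only [not_or, not_lt] at a2 a4
        constructor <;> linarith
      · simp only [OffLow, not_or, not_lt] at a1
        constructor <;> linarith
  have hoff : ∀ T : Finset E, T ⊆ S → l ∈ T → b ∈ T → ∀ f, IsSquareColoring u w T f →
      f l = f b → ∀ s ∈ T, OffLow u w l b s → f s ≠ f l := by
    intro T _ hl hb f hf hlb s hs hso hsl
    have h1 := hf.2 s hs l hl hsl
    have h2 := hf.2 s hs b hb (hsl.trans hlb)
    rcases hso with hso | hso <;> linarith
  have hne : ∀ T : Finset E, ∀ f, IsSquareColoring u w T f → ∀ s ∈ T, ∀ s' ∈ T,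
      (1 < u s - u s' ∨ 1 < w s - w s') → f s ≠ f s' := by
    intro T f hf s hs s' hs' hfar heq
    have h1 := hf.2 s hs s' hs' heq
    rcases hfar with hso | hso <;> linarith
  have hsame : ∀ p, OffLow (-u) (-w) r t p → ∀ T : Finset E, p ∈ T → r ∈ T → t ∈ T →
      ∀ f, IsSquareColoring u w T f → f r = f t → f p ≠ f r := by
    intro p hp T hpT hrT htT f hf hrt hpr
    have h1 := hf.2 r hrT p hpT hpr.symm
    have h2 := hf.2 t htT p hpT (hrt.symm.trans hpr.symm)
    rw [offLow_neg] at hp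
    rcases hp with hp | hp <;> linarith
  -- If a square took the lower left corner, `l'`, `e`, `r` would be pairwise far with only two
  -- colours left.
  by_cases hA : 1 < u e - u l' ∧ 1 < u r - u e
  · refine ⟨{l', e}, by simp [Finset.insert_subset_iff, heS, hl'.1],
      Finset.card_le_two.trans (by norm_num), ?_, Or.inl Finset.card_le_two⟩
    intro p hp q hq _ _ _ _ _ T hTS hB hpT hqT hlT hrT hbT htT f hf hlb
    have hl'T : l' ∈ T := hB (by simp)
    have heT : e ∈ T := hB (by simp)
    have o := hoff T hTS hlT hbT f hf hlb
    have o1 := o l' hl'T hl'.2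
    have o2 := o e heT he
    have o3 := o r hrT hr
    have n1 := hne T f hf e heT l' hl'T (Or.inl hA.1)
    have n2 := hne T f hf r hrT e heT (Or.inl hA.2)
    have n3 := hne T f hf r hrT l' hl'T (Or.inl (by linarith))
    have c1 := hf.1 l' hl'T
    have c2 := hf.1 e heT
    have c3 := hf.1 r hrT
    have c4 := hf.1 l hlT
    omega
  by_cases hB : 1 < w t - w e ∧ 1 < w e - w b'
  · refine ⟨{b', e}, by simp [Finset.insert_subset_iff, heS, hb'.1],
      Finset.card_le_two.trans (by norm_num), ?_, Or.inl Finset.card_le_two⟩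
    intro p hp q hq _ _ _ _ _ T hTS hB' hpT hqT hlT hrT hbT htT f hf hlb
    have hb'T : b' ∈ T := hB' (by simp)
    have heT : e ∈ T := hB' (by simp)
    have o := hoff T hTS hlT hbT f hf hlb
    have o1 := o b' hb'T hb'.2
    have o2 := o e heT he
    have o3 := o t htT ht
    have n1 := hne T f hf e heT b' hb'T (Or.inr hB.2)
    have n2 := hne T f hf t htT e heT (Or.inr hB.1)
    have n3 := hne T f hf t htT b' hb'T (Or.inr (by linarith))
    have c1 := hf.1 b' hb'T
    have c2 := hf.1 e heT
    have c3 := hf.1 t htT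
    have c4 := hf.1 l hlT
    omega
  -- Here `r` and `t` must share the colour not used by `e`. Neither `p` nor `q` can have it, so
  -- both take the colour of `e`, although they are far apart.
  by_cases hC : 1 < w t - w e ∧ 1 < u r - u e
  · refine ⟨{e}, by simpa using heS, by simp, ?_, Or.inl (by simp)⟩
    intro p hp q hq op oq op' oq' hpq T hTS hB' hpT hqT hlT hrT hbT htT f hf hlb
    have heT : e ∈ T := hB' (by simp)
    have o := hoff T hTS hlT hbT f hf hlb
    have o1 := o e heT he
    have o2 := o r hrT hr
    have o3 := o t htT ht
    have o4 := o p hpT op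
    have o5 := o q hqT oq
    have n1 := hne T f hf t htT e heT (Or.inr hC.1)
    have n2 := hne T f hf r hrT e heT (Or.inl hC.2)
    have n3 := hne T f hf q hqT p hpT hpq
    have s1 := hsame p op' T hpT hrT htT f hf
    have s2 := hsame q oq' T hqT hrT htT f hf
    have c1 := hf.1 e heT
    have c2 := hf.1 r hrT
    have c3 := hf.1 t htT
    have c4 := hf.1 l hlT
    have c5 := hf.1 p hpT
    have c6 := hf.1 q hqT
    omega
  have hx : 1 < u e - u l' := by
    by_contra hx
    exact (he1.resolve_left hx |> fun hy => he2.elim (fun hz => hC ⟨hy, hz⟩) fun hz => hB ⟨hy, hz⟩)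
  have hy : 1 < w e - w b' := by
    by_contra hy
    exact (he2.resolve_right hy |> fun hz => hA ⟨hx, hz⟩)
  have her := h.le_right e heS
  have het := h.le_top e heS
  have hl'off : OffLow (-u) (-w) r t l' := offLow_neg.2 (Or.inl (by linarith))
  have hb'off : OffLow (-u) (-w) r t b' := offLow_neg.2 (Or.inr (by linarith))
  refine ⟨{l', b', e}, by simp [Finset.insert_subset_iff, heS, hl'.1, hb'.1],
    Finset.card_le_three, ?_, Or.inr ⟨l', by simp, b', by simp, hl'.2, hb'.2, hl'off, hb'off,
      fun s hs hso => ⟨hlmin s hs hso, hbmin s hs hso⟩⟩⟩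
  -- Both `l'` and `b'` avoid the colour of `e`, so they agree; this forces `r` and `t` into the
  -- colour of `e`, and `p`, `q` conflict again.
  intro p hp q hq op oq op' oq' hpq T hTS hB' hpT hqT hlT hrT hbT htT f hf hlb
  have hl'T : l' ∈ T := hB' (by simp)
  have hb'T : b' ∈ T := hB' (by simp)
  have heT : e ∈ T := hB' (by simp)
  have o := hoff T hTS hlT hbT f hf hlb
  have o1 := o e heT he
  have o2 := o r hrT hr
  have o3 := o t htT ht
  have o4 := o p hpT op
  have o5 := o q hqT oq
  have o6 := o l' hl'T hl'.2
  have o7 := o b' hb'T hb'.2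
  have n1 := hne T f hf e heT l' hl'T (Or.inl hx)
  have n2 := hne T f hf e heT b' hb'T (Or.inr hy)
  have n3 := hne T f hf q hqT p hpT hpq
  have n4 := hne T f hf r hrT l' hl'T (Or.inl (by linarith))
  have n5 := hne T f hf t htT b' hb'T (Or.inr (by linarith))
  have s1 := hsame p op' T hpT hrT htT f hf
  have s2 := hsame q oq' T hqT hrT htT f hf
  have c1 := hf.1 e heT
  have c2 := hf.1 r hrT
  have c3 := hf.1 t htT
  have c4 := hf.1 l hlT
  have c5 := hf.1 p hpT
  have c6 := hf.1 q hqT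
  have c7 := hf.1 l' hl'T
  have c8 := hf.1 b' hb'T
  omega

/-- Six points of `S` that, together with the four bounding points, exclude the lower left and the
upper right corner squares from all covers by three unit squares. -/
theorem IsBounding.exists_diagonal (h : IsBounding u w S l r b t)
    (hS : ∀ f, ¬ IsSquareColoring u w S f) :
    ∃ A ⊆ S, A.card ≤ 6 ∧ ∀ T ⊆ S, A ⊆ T → l ∈ T → r ∈ T → b ∈ T → t ∈ T →
      ∀ f, IsSquareColoring u w T f → f l ≠ f b ∧ f r ≠ f t := by
  classical
  have hS' : ∀ f, ¬ IsSquareColoring (-u) (-w) S f := fun f hf => hS f (by simpa using hf.rotate)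
  obtain ⟨p, hp, q, hq, hp1, hq1, hp2, hq2, hpq⟩ := h.exists_far hS
  obtain ⟨B, hB, hBc, hBk, hBe⟩ := h.exists_corner hS
  obtain ⟨C, hC, hCc, hCk, hCe⟩ := h.rotate.exists_corner hS'
  simp only [neg_neg] at hCk hCe
  -- Both corners use the same far pair. When a corner needs three points, one of them can replace
  -- an end of the pair, so each corner costs at most two extra points.
  suffices hmain : ∃ p ∈ S, ∃ q ∈ S, OffLow u w l b p ∧ OffLow u w l b q ∧
      OffLow (-u) (-w) r t p ∧ OffLow (-u) (-w) r t q ∧ (1 < u q - u p ∨ 1 < w q - w p) ∧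
      (B ∪ C ∪ {p, q}).card ≤ 6 by
    obtain ⟨p, hp, q, hq, hp1, hq1, hp2, hq2, hpq, hcard⟩ := hmain
    refine ⟨B ∪ C ∪ {p, q}, ?_, hcard, ?_⟩
    · simp [Finset.union_subset_iff, Finset.insert_subset_iff, hB, hC, hp, hq]
    · intro T hTS hA hl hr hb ht f hf
      simp only [Finset.union_subset_iff, Finset.insert_subset_iff,
        Finset.singleton_subset_iff] at hA
      refine ⟨hBk p hp q hq hp1 hq1 hp2 hq2 hpq T hTS hA.1.1 hA.2.1 hA.2.2 hl hr hb ht f hf,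
        hCk q hq p hp hq2 hp2 hq1 hp1 ?_ T hTS hA.1.2 hA.2.2 hA.2.1 hr hl ht hb f hf.rotate⟩
      simpa only [Pi.neg_apply, neg_sub_neg] using hpq
  have hcard0 : ∀ p q : E, (B ∪ C ∪ {p, q}).card ≤ B.card + C.card + 2 := fun p q =>
    (Finset.card_union_le _ _).trans
      (add_le_add (Finset.card_union_le _ _) Finset.card_le_two)
  have hcard1 : ∀ p ∈ B ∪ C, ∀ q : E, (B ∪ C ∪ {p, q}).card ≤ B.card + C.card + 1 := by
    intro p hp q
    have : B ∪ C ∪ {p, q} = B ∪ C ∪ {q} := by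
      ext s; simp only [Finset.mem_union, Finset.mem_insert, Finset.mem_singleton] at hp ⊢
      constructor
      · rintro (h | rfl | h)
        exacts [Or.inl h, Or.inl hp, Or.inr h]
      · tauto
    rw [this]
    exact (Finset.card_union_le _ _).trans (add_le_add (Finset.card_union_le _ _) (by simp))
  have hcard2 : ∀ p ∈ B ∪ C, ∀ q ∈ B ∪ C, (B ∪ C ∪ {p, q}).card ≤ B.card + C.card := by
    intro p hp q hq
    rw [Finset.union_eq_left.2 (by simp only [Finset.insert_subset_iff,
      Finset.singleton_subset_iff]; exact ⟨hp, hq⟩)]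
    exact Finset.card_union_le _ _
  have hcomm : ∀ p q : E, B ∪ C ∪ {p, q} = B ∪ C ∪ {q, p} := fun p q => by
    rw [Finset.pair_comm]
  rcases hBe with hB2 | ⟨l', hl', b', hb', o1, o2, o3, o4, hBmin⟩ <;>
    rcases hCe with hC2 | ⟨r', hr', t', ht', o5, o6, o7, o8, hCmin⟩
  · exact ⟨p, hp, q, hq, hp1, hq1, hp2, hq2, hpq, (hcard0 p q).trans (by omega)⟩
  · have h1 := hCmin q hq hq2
    simp only [Pi.neg_apply, neg_le_neg_iff] at h1
    rcases hpq with hpq | hpq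
    · refine ⟨p, hp, r', hC hr', hp1, o7, hp2, o5, Or.inl (by linarith), ?_⟩
      rw [hcomm]
      exact (hcard1 r' (by simp [hr']) p).trans (by omega)
    · refine ⟨p, hp, t', hC ht', hp1, o8, hp2, o6, Or.inr (by linarith), ?_⟩
      rw [hcomm]
      exact (hcard1 t' (by simp [ht']) p).trans (by omega)
  · have h1 := hBmin p hp hp1
    rcases hpq with hpq | hpq
    · exact ⟨l', hB hl', q, hq, o1, hq1, o3, hq2, Or.inl (by linarith),
        (hcard1 l' (by simp [hl']) q).trans (by omega)⟩
    · exact ⟨b', hB hb', q, hq, o2, hq1, o4, hq2, Or.inr (by linarith),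
        (hcard1 b' (by simp [hb']) q).trans (by omega)⟩
  · have h1 := hBmin p hp hp1
    have h2 := hCmin q hq hq2
    simp only [Pi.neg_apply, neg_le_neg_iff] at h2
    rcases hpq with hpq | hpq
    · exact ⟨l', hB hl', r', hC hr', o1, o7, o3, o5, Or.inl (by linarith),
        (hcard2 l' (by simp [hl']) r' (by simp [hr'])).trans (by omega)⟩
    · exact ⟨b', hB hb', t', hC ht', o2, o8, o4, o6, Or.inr (by linarith),
        (hcard2 b' (by simp [hb']) t' (by simp [ht'])).trans (by omega)⟩

/-- The Helly number for covering by three translates of a square is at most 16. -/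
theorem exists_card_le_not_isSquareColoring (hS : ∀ f, ¬ IsSquareColoring u w S f) :
    ∃ T ⊆ S, T.card ≤ 16 ∧ ∀ f, ¬ IsSquareColoring u w T f := by
  classical
  have hne : S.Nonempty := by
    rw [Finset.nonempty_iff_ne_empty]
    rintro rfl
    exact hS (fun _ => 0) ⟨by simp, by simp⟩
  obtain ⟨l, hl, hlm⟩ := S.exists_min_image u hne
  obtain ⟨r, hr, hrm⟩ := S.exists_max_image u hne
  obtain ⟨b, hb, hbm⟩ := S.exists_min_image w hne
  obtain ⟨t, ht, htm⟩ := S.exists_max_image w hne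
  -- A thin bounding box reduces to dimension one, where four points suffice.
  by_cases hw : u r - u l ≤ 1
  · rcases exists_separated_or_coloring w 3 S with ⟨T, hT, hc, hsep⟩ | ⟨f, hf, hfS⟩
    · exact ⟨T, hT, by omega, fun f hf => not_coloring_of_separated hc hsep f hf.1
        fun s hs s' hs' he => (hf.2 s hs s' hs' he).2⟩
    · exact absurd ⟨hf, fun s hs s' hs' he =>
        ⟨by linarith [hrm s hs, hlm s' hs'], hfS s hs s' hs' he⟩⟩ (hS f)
  by_cases hh : w t - w b ≤ 1
  · rcases exists_separated_or_coloring u 3 S with ⟨T, hT, hc, hsep⟩ | ⟨f, hf, hfS⟩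
    · exact ⟨T, hT, by omega, fun f hf => not_coloring_of_separated hc hsep f hf.1
        fun s hs s' hs' he => (hf.2 s hs s' hs' he).1⟩
    · exact absurd ⟨hf, fun s hs s' hs' he =>
        ⟨hfS s hs s' hs' he, by linarith [htm s hs, hbm s' hs']⟩⟩ (hS f)
  push Not at hw hh
  have hbd : IsBounding u w S l r b t := ⟨hl, hr, hb, ht, hlm, hrm, hbm, htm, hw, hh⟩
  obtain ⟨A, hA, hAc, hAk⟩ := hbd.exists_diagonal hS
  obtain ⟨B, hB, hBc, hBk⟩ := hbd.reflect.exists_diagonal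
    (fun f hf => hS f (by simpa using hf.reflect))
  have h4 : ({l, r, b, t} : Finset E).card ≤ 4 := Finset.card_le_four
  have hTS : A ∪ B ∪ {l, r, b, t} ⊆ S := by
    simp [Finset.union_subset_iff, Finset.insert_subset_iff, hA, hB, hl, hr, hb, ht]
  have lT : l ∈ A ∪ B ∪ {l, r, b, t} := by simp
  have rT : r ∈ A ∪ B ∪ {l, r, b, t} := by simp
  have bT : b ∈ A ∪ B ∪ {l, r, b, t} := by simp
  have tT : t ∈ A ∪ B ∪ {l, r, b, t} := by simp
  refine ⟨A ∪ B ∪ {l, r, b, t}, hTS, ?_, fun f hf => ?_⟩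
  · have h1 := Finset.card_union_le (A ∪ B) {l, r, b, t}
    have h2 := Finset.card_union_le A B
    omega
  · have h1 := hAk _ hTS (Finset.subset_union_left.trans Finset.subset_union_left)
      lT rT bT tT f hf
    have h2 := hBk _ hTS (Finset.subset_union_right.trans Finset.subset_union_left)
      lT rT tT bT f hf.reflect
    -- With all four corners excluded, the extreme points would need four distinct colours.
    have n1 : f r ≠ f l := fun he => by linarith [(hf.2 r rT l lT he).1]
    have n2 : f t ≠ f b := fun he => by linarith [(hf.2 t tT b bT he).2]
    have c1 := hf.1 l lT
    have c2 := hf.1 r rT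
    have c3 := hf.1 b bT
    have c4 := hf.1 t tT
    omega

end

theorem exists_card_le_not_unitColorable_three {E : Type*} (x : E → Fin 2 → ℝ) (S : Finset E)
    (hS : ¬ UnitColorable x 3 S) : ∃ T ⊆ S, T.card ≤ 16 ∧ ¬ UnitColorable x 3 T := by
  have key : ∀ T : Finset E, UnitColorable x 3 T ↔
      ∃ f, IsSquareColoring (fun s => x s 0) (fun s => x s 1) T f := by
    intro T
    simp only [UnitColorable, IsSquareColoring, Fin.forall_fin_two]
  simp only [key, not_exists] at hS ⊢
  exact exists_card_le_not_isSquareColoring hS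

/-! ### Assembling the cases -/

/-- The Helly property for covering by `m` unit cubes of `ℝ^d`. -/
theorem exists_card_le_not_unitColorable {E : Type*} {d m h : ℕ} (hd : 0 < d)
    (hh : danzerGrunbaumNumber d m = (h : ℕ∞)) (x : E → Fin d → ℝ) (S : Finset E)
    (hS : ¬ UnitColorable x m S) : ∃ T ⊆ S, T.card ≤ h ∧ ¬ UnitColorable x m T := by
  unfold danzerGrunbaumNumber at hh
  by_cases hm : m = 1
  · subst hm
    rw [if_pos rfl] at hh
    obtain rfl : 2 = h := by exact_mod_cast hh
    exact exists_card_le_not_unitColorable_one x S hS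
  rw [if_neg hm] at hh
  by_cases hd1 : d = 1
  · subst hd1
    rw [if_pos rfl] at hh
    obtain rfl : m + 1 = h := by exact_mod_cast hh
    exact exists_card_le_not_unitColorable_unique x m S hS
  rw [if_neg hd1] at hh
  by_cases hm2 : m = 2
  · subst hm2
    refine exists_card_le_not_unitColorable_two (by omega) (fun n hn hle => ?_) x S hS
    rw [if_pos rfl] at hh
    split_ifs at hh with ho
    · obtain rfl : 3 * d = h := by exact_mod_cast hh
      exact hle
    · obtain rfl : 3 * d - 1 = h := by exact_mod_cast hh
      -- For even `d`, an odd length cannot equal `3 * d`.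
      rw [Nat.odd_iff] at *
      omega
  rw [if_neg hm2] at hh
  split_ifs at hh with h23
  · obtain ⟨rfl, rfl⟩ := h23
    obtain rfl : 16 = h := by exact_mod_cast hh
    exact exists_card_le_not_unitColorable_three x S hS
  · exact absurd hh (ENat.top_ne_natCast h)

theorem mainTheorem9 (d m h : ℕ) (hd : 0 < d) (hm : 0 < m)
    (hh : danzerGrunbaumNumber d m = (h : ℕ∞))
    (v : Fin d → EuclideanSpace ℝ (Fin d)) (hv : LinearIndependent ℝ v)
    (S : Finset (EuclideanSpace ℝ (Fin d))) (hS : h ≤ S.card)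
    (hcov : ∀ T : Finset (EuclideanSpace ℝ (Fin d)), T ⊆ S → T.card = h →
      ContainedInTranslates m (parallelepiped v) (T : Set (EuclideanSpace ℝ (Fin d)))) :
    ContainedInTranslates m (parallelepiped v) (S : Set (EuclideanSpace ℝ (Fin d))) := by
  have : Nonempty (Fin d) := ⟨⟨0, hd⟩⟩
  let b := basisOfLinearIndependentOfCardEqFinrank hv (by simp)
  have hb : ⇑b = v := coe_basisOfLinearIndependentOfCardEqFinrank hv _
  rw [← hb] at hcov ⊢
  rw [containedInTranslates_iff_unitColorable hm]
  by_contra hcon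
  obtain ⟨T, hTS, hTc, hT⟩ := exists_card_le_not_unitColorable hd hh _ S hcon
  -- The obstruction is padded to exactly `h` points, which is where `hS` enters.
  obtain ⟨T', hTT', hT'S, hT'c⟩ := Finset.exists_subsuperset_card_eq hTS hTc hS
  obtain ⟨f, hf, hf'⟩ := (containedInTranslates_iff_unitColorable hm b T').1 (hcov T' hT'S hT'c)
  exact hT ⟨f, fun s hs => hf s (hTT' hs),
    fun s hs t ht => hf' s (hTT' hs) t (hTT' ht)⟩
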